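/- **Setting.** Let $C_0(\mathbb R,\mathbb R)$ be the space of continuous $\omega:\mathbb R\to\mathbb R$ with $\omega(0)=0$, with the compact-open topology, its Borel $\sigma$-algebra, the two-sided Wiener measure $\mathbb P$ and the flow $\theta_t\omega=\omega(\cdot+t)-\omega(t)$. Let $\Omega\subset C_0(\mathbb R,\mathbb R)$ be a Borel set with $\mathbb P(\Omega)=1$, $\theta_t\Omega=\Omega$ for all $t\in\mathbb R$, and $\lim_{t\to\pm\infty}|\omega(t)|/|t|=0$ for every $\omega\in\Omega$; it carries the trace $\sigma$-algebra $\mathcal F$. Put $z(\omega)=-\int_{-\infty}^0e^{\tau}\omega(\tau)\,d\tau$, so that $t\mapsto z(\theta_t\omega)$ is the stationary Ornstein–Uhlenbeck process solving $dz+z\,dt=dW$. Let $H$ be a separable Banach space, and let $A$ generate a $C_0$-semigroup $S$ on $H$ that has an exponential dichotomy with exponents $\hat\lambda>\check\lambda$ and bound $1$: there is a continuous projection $\pi^+$ commuting with every $S(t)$, $t\ge 0$, such that each $S(t)$, $t\ge0$, maps $H^+=\pi^+H$ isomorphically onto itself ($S(-t)$ denoting the inverse there) and, with $\pi^-=I-\pi^+$,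 $\|\pi^+S(t)\pi^+\|\le e^{\hat\lambda t}$ for $t\le 0$ and $\|\pi^-S(t)\pi^-\|\le e^{\check\lambda t}$ for $t\ge0$. Put $H^-=\pi^-H$. Let $F:H\to H$ satisfy $F(0)=0$ and $\|\pi^\pm(F(x_1)-F(x_2))\|\le L\|x_1-x_2\|$ for all $x_1,x_2\in H$, with $L>0$. Let $G(\omega,u)=e^{-z(\omega)}F(e^{z(\omega)}u)$ and let $\phi:\mathbb R^+\times\Omega\times H\to H$ be the random dynamical system generated by $\frac{d\phi}{dt}=A\phi+G(\theta_t\omega,\phi)+z(\theta_t\omega)\phi$, $\phi(0)=x$, i.e. for all $\omega\in\Omega$ and $x\in H$ the map $t\mapsto\phi(t)=\phi(t,\omega,x)$ is continuous on $[0,\infty)$ and $$\phi(t)=e^{\int_0^tz(\theta_\tau\omega)d\tau}S(t)x+\int_0^te^{\int_\tau^tz(\theta_r\omega)dr}S(t-\tau)G(\theta_\tau\omega,\phi(\tau))\,d\tau ,\qquad t\ge0 .$$ Let $T(\omega,x)=xe^{-z(\omega)}$, $T^{-1}(\omega,x)=xe^{z(\omega)}$, and let $$\hat\phi(t,\omega,x)=T^{-1}\bigl(\theta_t\omega,\phi(t,\omega,T(\omega,x))\bigr)$$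 (this is the version of the solution of the Stratonovich equation $d\phi=(A\phi+F(\phi))\,dt+\phi\circ dW$ obtained from $\phi$ by conjugation). **Definitions.** Let $\psi:\mathbb R^+\times\Omega\times H\to H$. A *Lipschitz invariant manifold* of $\psi$ is a family $M=\{M(\omega)\}_{\omega\in\Omega}$ of nonempty closed subsets of $H$ such that $\omega\mapsto\inf_{y\in M(\omega)}\|x-y\|$ is $\mathcal F$-measurable for every $x\in H$, such that $\psi(t,\omega,M(\omega))\subset M(\theta_t\omega)$ for all $t\ge0$, $\omega\in\Omega$, and such that $M(\omega)=\{x^++\gamma(\omega,x^+):x^+\in H^+\}$ with $\gamma(\omega,\cdot):H^+\to H^-$ Lipschitz continuous for every $\omega$. It is an *unstable manifold* of $\psi$ if moreover for every $\omega\in\Omega$ and $x\in M(\omega)$ there are $x_{-t}\in M(\theta_{-t}\omega)$, $t\ge0$, with $\psi(t,\theta_{-t}\omega,x_{-t})=x$ that tend to zero exponentially fast, i.e. $e^{\mu t}\|x_{-t}\|\to0$ as $t\to\infty$ for some $\mu>0$. **Theorem 4.4.** Let $M(\omega)\subset H$, $\omega\in\Omega$, be a family of sets and put $\hat M(\omega)=T^{-1}(\omega,M(\omega))$.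 Then $M$ is a Lipschitz invariant manifold of $\phi$ if and only if $\hat M$ is a Lipschitz invariant manifold of $\hat\phi$. Moreover, $M$ is an unstable manifold of $\phi$ if and only if $\hat M$ is an unstable manifold of $\hat\phi$. -/

import Mathlib

open Set Filter Topology MeasureTheory ProbabilityTheory

noncomputable section

namespace RandomManifold

/-! ### The canonical Brownian flow -/

/-- The space `C₀(ℝ, ℝ)` of continuous paths vanishing at `0`, with the compact-open topology
(inherited from `C(ℝ, ℝ)`). -/
abbrev PathSpace : Type := {f : C(ℝ, ℝ) // f 0 = 0}

/-- The Borel σ-algebra of the compact-open topology. -/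
instance : MeasurableSpace PathSpace := borel PathSpace

instance : BorelSpace PathSpace := ⟨rfl⟩

/-- The value `ω(t)` of a path. -/
def coord (t : ℝ) (ω : PathSpace) : ℝ := ω.1 t

/-- The Wiener shift `θ_t ω = ω(· + t) - ω(t)`. -/
def shift (t : ℝ) (ω : PathSpace) : PathSpace :=
  ⟨⟨fun s => ω.1 (s + t) - ω.1 t, by fun_prop⟩, by simp⟩

/-- `P` is the two-sided Wiener measure: under `P` the coordinate process (which vanishes at `0`
and has continuous paths) has independent increments, the increment over `[s, t]` being
centred Gaussian with variance `t - s`. -/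
structure IsWienerMeasure (P : Measure PathSpace) : Prop where
  isProbabilityMeasure : IsProbabilityMeasure P
  indep_increments : HasIndepIncrements coord P
  gaussian_increments : ∀ s t : ℝ, s ≤ t →
    P.map (fun ω => coord t ω - coord s ω) = gaussianReal 0 (t - s).toNNReal

/-- `Ω` is a shift-invariant Borel set of paths of full measure, all of sublinear growth. -/
structure IsNoiseSpace (P : Measure PathSpace) (Ω : Set PathSpace) : Prop where
  measurableSet : MeasurableSet Ω
  shift_image : ∀ t : ℝ, shift t '' Ω = Ω
  full : P Ω = 1
  sublinear_atTop : ∀ ω ∈ Ω, Tendsto (fun t : ℝ => |coord t ω| / |t|) atTop (𝓝 0)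
  sublinear_atBot : ∀ ω ∈ Ω, Tendsto (fun t : ℝ => |coord t ω| / |t|) atBot (𝓝 0)

/-- The flow `θ` restricted to the noise space `Ω` (which carries the trace σ-algebra). -/
def flow {P : Measure PathSpace} {Ω : Set PathSpace} (h : IsNoiseSpace P Ω) (t : ℝ) (ω : Ω) : Ω :=
  ⟨shift t ω.1, (h.shift_image t).subset (mem_image_of_mem (shift t) ω.2)⟩

/-- The random variable `z(ω) = -∫_{-∞}^0 e^τ ω(τ) dτ`, for which `t ↦ z(θ_t ω)` is the stationary
Ornstein–Uhlenbeck process solving `dz + z dt = dW`. -/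
def ouVar (ω : PathSpace) : ℝ := -∫ τ in Iic (0 : ℝ), Real.exp τ * coord τ ω

/-! ### The linear part -/

section Linear

variable {H : Type*} [NormedAddCommGroup H] [NormedSpace ℝ H]

/-- `S` is a strongly continuous semigroup on `H` (only its values at times `t ≥ 0` matter). -/
structure IsC0Semigroup (S : ℝ → H →L[ℝ] H) : Prop where
  zero : S 0 = ContinuousLinearMap.id ℝ H
  add : ∀ s t : ℝ, 0 ≤ s → 0 ≤ t → S (s + t) = (S s).comp (S t)
  continuousOn : ∀ x : H, ContinuousOn (fun t => S t x) (Ici 0)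

/-- The unbounded operator `A : D(A) → H` is the generator of `S`: `x ∈ D(A)` with `A x = y` iff
`(S(h) x - x) / h → y` as `h ↓ 0`. -/
def IsGenerator (A : H →ₗ.[ℝ] H) (S : ℝ → H →L[ℝ] H) : Prop :=
  ∀ x y : H, (x, y) ∈ A.graph ↔ Tendsto (fun h : ℝ => h⁻¹ • (S h x - x)) (𝓝[>] 0) (𝓝 y)

/-- The complementary projection `π⁻ = I - π⁺`. -/
def complProj (πp : H →L[ℝ] H) : H →L[ℝ] H := ContinuousLinearMap.id ℝ H - πp

/-- The space `H⁺ = R(π⁺)`. -/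
abbrev spacePlus (πp : H →L[ℝ] H) : Submodule ℝ H := LinearMap.range (πp : H →ₗ[ℝ] H)

/-- The space `H⁻ = R(π⁻)`. -/
abbrev spaceMinus (πp : H →L[ℝ] H) : Submodule ℝ H :=
  LinearMap.range (complProj πp : H →ₗ[ℝ] H)

/-- Exponential dichotomy with exponents `lamHat > lamCheck`, bound `1` and projection `π⁺`.
In `bound_plus`, `y` is `S(-t) π⁺ x`, the preimage of `π⁺ x` in `R(π⁺)` under `S(t)`, so the
inequality says `‖π⁺ S(-t) π⁺‖ ≤ e^{- lamHat t}` for `t ≥ 0`. -/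
structure ExpDichotomy (S : ℝ → H →L[ℝ] H) (πp : H →L[ℝ] H) (lamHat lamCheck : ℝ) : Prop where
  lt : lamCheck < lamHat
  proj : πp.comp πp = πp
  comm : ∀ t : ℝ, 0 ≤ t → πp.comp (S t) = (S t).comp πp
  bijOn : ∀ t : ℝ, 0 ≤ t → BijOn (S t) (range πp) (range πp)
  bound_plus : ∀ t : ℝ, 0 ≤ t → ∀ x y : H, y ∈ range πp → S t y = πp x →
    ‖y‖ ≤ Real.exp (-(lamHat * t)) * ‖x‖
  bound_minus : ∀ t : ℝ, 0 ≤ t →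
    ‖(complProj πp).comp ((S t).comp (complProj πp))‖ ≤ Real.exp (lamCheck * t)

end Linear

/-! ### The random evolution equation, and the transform -/

section Equation

variable {H : Type*} [NormedAddCommGroup H] [NormedSpace ℝ H]
  {P : Measure PathSpace} {Ω : Set PathSpace}

/-- The transform `T(ω, x) = x e^{-z(ω)}`. -/
def transform (ω : Ω) (x : H) : H := Real.exp (-ouVar ω.1) • x

/-- Its inverse `T⁻¹(ω, x) = x e^{z(ω)}`. -/
def transformInv (ω : Ω) (x : H) : H := Real.exp (ouVar ω.1) • x

/-- The transformed nonlinearity `G(ω, u) = e^{-z(ω)} F(e^{z(ω)} u)`. -/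
def transNonlin (F : H → H) (ω : Ω) (u : H) : H :=
  Real.exp (-ouVar ω.1) • F (Real.exp (ouVar ω.1) • u)

/-- `φ` is the solution map of the random evolution equation
`dφ/dt = A φ + G(θ_t ω, φ) + z(θ_t ω) φ`, `φ(0) = x`: for every `ω ∈ Ω` and every `x ∈ H`,
`t ↦ φ(t, ω, x)` is a (continuous) mild solution on `[0, ∞)`. -/
def IsMildSolutionMap (h : IsNoiseSpace P Ω) (S : ℝ → H →L[ℝ] H) (F : H → H)
    (φ : ℝ → Ω → H → H) : Prop :=
  ∀ (ω : Ω) (x : H), ContinuousOn (fun t => φ t ω x) (Ici 0) ∧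
    ∀ t : ℝ, 0 ≤ t →
      φ t ω x = Real.exp (∫ τ in (0 : ℝ)..t, ouVar (flow h τ ω).1) • S t x +
        ∫ τ in (0 : ℝ)..t, Real.exp (∫ r in τ..t, ouVar (flow h r ω).1) •
          S (t - τ) (transNonlin F (flow h τ ω) (φ τ ω x))

/-- The conjugated map `φ̂(t, ω, x) = T⁻¹(θ_t ω, φ(t, ω, T(ω, x)))`. -/
def conjugate (h : IsNoiseSpace P Ω) (φ : ℝ → Ω → H → H) (t : ℝ) (ω : Ω) (x : H) : H :=
  transformInv (flow h t ω) (φ t ω (transform ω x))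

/-- `T⁻¹(ω, M(ω))`. -/
def conjugateSet (M : Ω → Set H) (ω : Ω) : Set H := transformInv ω '' M ω

end Equation

/-! ### Invariant manifolds -/

section Manifolds

variable {Ω : Type*} [MeasurableSpace Ω] {H : Type*} [NormedAddCommGroup H] [NormedSpace ℝ H]

/-- A random set: a family of nonempty closed sets such that the distance from any given point is
a random variable. -/
structure IsRandomSet (M : Ω → Set H) : Prop where
  nonempty : ∀ ω, (M ω).Nonempty
  isClosed : ∀ ω, IsClosed (M ω)
  measurable_infDist : ∀ x : H, Measurable fun ω => Metric.infDist x (M ω)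

/-- An invariant set: a random set `M` with `φ(t, ω, M(ω)) ⊆ M(θ_t ω)` for `t ≥ 0`. -/
structure IsInvariantSet (θ : ℝ → Ω → Ω) (φ : ℝ → Ω → H → H) (M : Ω → Set H) : Prop where
  isRandomSet : IsRandomSet M
  invariant : ∀ t : ℝ, 0 ≤ t → ∀ ω, φ t ω '' M ω ⊆ M (θ t ω)

/-- A Lipschitz continuous invariant manifold: an invariant set which is the graph of a Lipschitz
mapping `γ(ω, ·) : H⁺ → H⁻`. -/
structure IsInvariantManifold (πp : H →L[ℝ] H) (θ : ℝ → Ω → Ω) (φ : ℝ → Ω → H → H)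
    (M : Ω → Set H) : Prop where
  isInvariantSet : IsInvariantSet θ φ M
  graph : ∃ γ : Ω → spacePlus πp → spaceMinus πp, ∀ ω,
    (∃ K : NNReal, LipschitzWith K (γ ω)) ∧
      M ω = range fun x : spacePlus πp => (x : H) + (γ ω x : H)

/-- An unstable manifold: an invariant manifold `M` such that each `x ∈ M(ω)` has preimages
`x_{-t} ∈ M(θ_{-t} ω)` under `φ(t, θ_{-t} ω, ·)`, `t ≥ 0`, which tend to zero exponentially fast
as `t → ∞`. -/
structure IsUnstableManifold (πp : H →L[ℝ] H) (θ : ℝ → Ω → Ω) (φ : ℝ → Ω → H → H)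
    (M : Ω → Set H) : Prop where
  isInvariantManifold : IsInvariantManifold πp θ φ M
  backward : ∀ ω, ∀ x ∈ M ω, ∃ ξ : ℝ → H,
    (∀ t : ℝ, 0 ≤ t → ξ t ∈ M (θ (-t) ω) ∧ φ t (θ (-t) ω) (ξ t) = x) ∧
    ∃ μ : ℝ, 0 < μ ∧ Tendsto (fun t : ℝ => Real.exp (μ * t) * ‖ξ t‖) atTop (𝓝 0)

end Manifolds

end RandomManifold

end

namespace RandomManifold

/-! ### The stationary Ornstein–Uhlenbeck process -/

/-! The transform is multiplication by the positive random scalar `e^{z(ω)}`. A scalar respects the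
splitting `H⁺ ⊕ H⁻`, so it carries Lipschitz graphs to Lipschitz graphs, and it intertwines the two
cocycles by construction. Measurability of `z` keeps random sets random. Only exponential decay of
backward orbits needs an estimate: `z(θ_{-t} ω)` grows sublinearly
(`exists_abs_ouVar_shift_neg_le`), so the scalar costs an arbitrarily small part of the decay rate.
All this is proved once for dilations by `e^{a(ω)}`; the converses follow on replacing `a` by `-a`.
-/

lemma measurable_coord (t : ℝ) : Measurable (coord t) := by
  have h : Continuous (coord t) := by
    unfold coord
    exact (continuous_eval_const t).comp continuous_subtype_val
  exact h.measurable

/-- Evaluation is continuous in time and measurable in the path, hence jointly measurable, and a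
parameter integral of such a function is measurable. Integrability is not needed: where it fails the
integral is `0` by convention. -/
lemma measurable_ouVar : Measurable ouVar := by
  have h : StronglyMeasurable (Function.uncurry fun (τ : ℝ) (ω : PathSpace) => coord τ ω) :=
    stronglyMeasurable_uncurry_of_continuous_of_stronglyMeasurable
      (fun ω => ω.1.continuous) (fun τ => (measurable_coord τ).stronglyMeasurable)
  have h' : StronglyMeasurable fun p : PathSpace × ℝ => Real.exp p.2 * coord p.2 p.1 :=
    (Real.measurable_exp.comp measurable_snd).stronglyMeasurable.mul
      (h.comp_measurable measurable_swap)
  exact (h'.integral_prod_right (ν := volume.restrict (Iic (0 : ℝ)))).neg.measurable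

/-- A path of sublinear growth at `-∞` is bounded on the negative half-line by an affine function
of arbitrarily small slope. -/
lemma exists_abs_coord_le {ω : PathSpace}
    (h : Tendsto (fun t : ℝ => |coord t ω| / |t|) atBot (𝓝 0)) {ε : ℝ} (hε : 0 < ε) :
    ∃ C : ℝ, 0 ≤ C ∧ ∀ s ≤ 0, |coord s ω| ≤ C + ε * |s| := by
  obtain ⟨R, hR⟩ := 
    (((tendsto_order.1 h).2 ε hε).and (eventually_lt_atBot (0 : ℝ))).exists_forall_of_atBot
  obtain ⟨C, hC⟩ := (isCompact_Icc (a := R) (b := 0)).exists_bound_of_continuousOn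
    (f := fun s => coord s ω) ω.1.continuous.continuousOn
  refine ⟨max C 0, le_max_right _ _, fun s hs => ?_⟩
  rcases le_total s R with hsR | hsR
  · obtain ⟨h₁, h₂⟩ := hR s hsR
    have := (div_lt_iff₀ (abs_pos.2 h₂.ne)).1 h₁
    linarith [le_max_right C 0]
  · have h₁ := hC s ⟨hsR, hs⟩
    rw [Real.norm_eq_abs] at h₁
    linarith [le_max_left C 0, mul_nonneg hε.le (abs_nonneg s)]

/-- `t ↦ z(θ_{-t} ω)` grows sublinearly. -/
lemma exists_abs_ouVar_shift_neg_le {ω : PathSpace}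
    (h : Tendsto (fun t : ℝ => |coord t ω| / |t|) atBot (𝓝 0)) {ε : ℝ} (hε : 0 < ε) :
    ∃ C : ℝ, ∀ t, 0 ≤ t → |ouVar (shift (-t) ω)| ≤ C + ε * t := by
  -- The shifted path is a difference of two values of `ω`, so each may use slope `ε / 2`.
  obtain ⟨C, -, hb⟩ := exists_abs_coord_le h (half_pos hε)
  have hexp : IntegrableOn Real.exp (Iic 0) := integrableOn_exp_Iic 0
  have hlin : IntegrableOn (fun τ : ℝ => Real.exp (τ / 2)) (Iic 0) := by
    simpa [div_eq_inv_mul] using integrableOn_exp_mul_Iic (a := 2⁻¹) (by norm_num) 0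
  refine ⟨2 * C + ε * ∫ τ in Iic (0 : ℝ), Real.exp (τ / 2), fun t ht => ?_⟩
  have hint : IntegrableOn
      (fun τ : ℝ => Real.exp τ * (2 * C + ε * t) + ε * Real.exp (τ / 2)) (Iic 0) :=
    (hexp.mul_const _).add (hlin.const_mul _)
  have hle : ‖∫ τ in Iic (0 : ℝ), Real.exp τ * coord τ (shift (-t) ω)‖ ≤
      ∫ τ in Iic (0 : ℝ), (Real.exp τ * (2 * C + ε * t) + ε * Real.exp (τ / 2)) := by
    refine norm_integral_le_of_norm_le hint ?_
    filter_upwards [ae_restrict_mem measurableSet_Iic] with τ hτ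
    have hτ : τ ≤ 0 := hτ
    have h₁ := hb (τ + -t) (by linarith)
    have h₂ := hb (-t) (by linarith)
    rw [abs_of_nonpos (a := τ + -t) (by linarith)] at h₁
    rw [abs_of_nonpos (a := -t) (by linarith)] at h₂
    have h₃ : |coord τ (shift (-t) ω)| ≤ (2 * C + ε * t) + ε * (-τ / 2) := by
      have : coord τ (shift (-t) ω) = coord (τ + -t) ω - coord (-t) ω := rfl
      rw [this]
      calc _ ≤ |coord (τ + -t) ω| + |coord (-t) ω| := abs_sub _ _
        _ ≤ _ := by linarith
    -- Half of the exponential weight absorbs the linear factor, through `x ≤ e^x`.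
    have h₄ : Real.exp τ * (-τ / 2) ≤ Real.exp (τ / 2) := by
      have h₅ : -τ / 2 ≤ Real.exp (-τ / 2) := by linarith [Real.add_one_le_exp (-τ / 2)]
      calc Real.exp τ * (-τ / 2) ≤ Real.exp τ * Real.exp (-τ / 2) := by gcongr
        _ = Real.exp (τ / 2) := by rw [← Real.exp_add]; ring_nf
    rw [norm_mul, Real.norm_eq_abs, Real.norm_eq_abs, Real.abs_exp]
    calc Real.exp τ * |coord τ (shift (-t) ω)|
        ≤ Real.exp τ * ((2 * C + ε * t) + ε * (-τ / 2)) := by gcongr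
      _ = Real.exp τ * (2 * C + ε * t) + ε * (Real.exp τ * (-τ / 2)) := by ring
      _ ≤ _ := by gcongr
  rw [integral_add (hexp.mul_const _) (hlin.const_mul _), integral_mul_const,
    integral_const_mul, integral_exp_Iic_zero, one_mul] at hle
  rw [ouVar, abs_neg, ← Real.norm_eq_abs]
  linarith

lemma shift_shift_neg (t : ℝ) (ω : PathSpace) : shift t (shift (-t) ω) = ω := by
  apply Subtype.ext
  ext s
  have h : ω.1 0 = 0 := ω.2
  simp [shift, h]

lemma flow_flow_neg {P : Measure PathSpace} {Ω : Set PathSpace} (h : IsNoiseSpace P Ω) (t : ℝ)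
    (ω : Ω) : flow h t (flow h (-t) ω) = ω :=
  Subtype.ext (shift_shift_neg t ω.1)

/-! ### Conjugation of invariant manifolds by random dilations -/

section Dilation

variable {Ω : Type*} {H : Type*} [NormedAddCommGroup H] [NormedSpace ℝ H]

/-- The image of a family of sets under the random dilation by `e^{a(ω)}`. -/
noncomputable def dilateSet (a : Ω → ℝ) (M : Ω → Set H) (ω : Ω) : Set H :=
  (fun x => Real.exp (a ω) • x) '' M ω

/-- The conjugate of `φ` under the random dilation by `e^{a(ω)}`. -/
noncomputable def dilateMap (θ : ℝ → Ω → Ω) (a : Ω → ℝ) (φ : ℝ → Ω → H → H) (t : ℝ) (ω : Ω) (x : H) : H :=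
  Real.exp (a (θ t ω)) • φ t ω (Real.exp (-a ω) • x)

lemma dilateSet_neg_dilateSet (a : Ω → ℝ) (M : Ω → Set H) :
    dilateSet (-a) (dilateSet a M) = M := by
  ext ω x
  simp [dilateSet, image_image, smul_smul, ← Real.exp_add]

lemma dilateMap_neg_dilateMap (θ : ℝ → Ω → Ω) (a : Ω → ℝ) (φ : ℝ → Ω → H → H) :
    dilateMap θ (-a) (dilateMap θ a φ) = φ := by
  ext t ω x
  simp [dilateMap, smul_smul, ← Real.exp_add]

lemma dilateMap_smul (θ : ℝ → Ω → Ω) (a : Ω → ℝ) (φ : ℝ → Ω → H → H) (t : ℝ) (ω : Ω) (x : H) :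
    dilateMap θ a φ t ω (Real.exp (a ω) • x) = Real.exp (a (θ t ω)) • φ t ω x := by
  simp [dilateMap, smul_smul, ← Real.exp_add]

lemma infDist_dilateSet (a : Ω → ℝ) (M : Ω → Set H) (ω : Ω) (x : H) :
    Metric.infDist x (dilateSet a M ω) =
      Real.exp (a ω) * Metric.infDist (Real.exp (-a ω) • x) (M ω) := by
  have h := infDist_smul₀ (Real.exp_ne_zero (a ω)) (M ω) (Real.exp (-a ω) • x)
  rw [smul_smul, ← Real.exp_add, add_neg_cancel, Real.exp_zero, one_smul, Real.norm_eq_abs,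
    Real.abs_exp] at h
  exact h

variable [MeasurableSpace Ω]

/-- The distance is continuous in the scalar and measurable in `ω`, so a random scalar may be
substituted. It suffices to move the point along one line, so separability of `H` plays no role. -/
lemma IsRandomSet.measurable_infDist_smul {M : Ω → Set H} (hM : IsRandomSet M) {r : Ω → ℝ}
    (hr : Measurable r) (x : H) : Measurable fun ω => Metric.infDist (r ω • x) (M ω) := by
  have hc (ω : Ω) : Continuous fun s : ℝ => Metric.infDist (s • x) (M ω) := by
    have hs : Continuous fun s : ℝ => s • x := by fun_prop
    exact (Metric.continuous_infDist_pt (M ω)).comp hs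
  have h := measurable_uncurry_of_continuous_of_measurable
    (u := fun (s : ℝ) (ω : Ω) => Metric.infDist (s • x) (M ω)) hc
    fun s => hM.measurable_infDist (s • x)
  have hr' : Measurable fun ω => (r ω, ω) := hr.prodMk measurable_id
  simpa [Function.comp_def] using h.comp hr'

lemma IsRandomSet.dilate {M : Ω → Set H} (hM : IsRandomSet M) {a : Ω → ℝ} (ha : Measurable a) :
    IsRandomSet (dilateSet a M) := by
  refine ⟨fun ω => (hM.nonempty ω).image _, fun ω => ?_, fun x => ?_⟩
  · exact isClosedMap_smul_of_ne_zero (Real.exp_ne_zero (a ω)) _ (hM.isClosed ω)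
  · simp_rw [infDist_dilateSet]
    exact (Real.measurable_exp.comp ha).mul
      (hM.measurable_infDist_smul (Real.measurable_exp.comp ha.neg) x)

lemma IsInvariantSet.dilate {θ : ℝ → Ω → Ω} {φ : ℝ → Ω → H → H} {M : Ω → Set H}
    (hM : IsInvariantSet θ φ M) {a : Ω → ℝ} (ha : Measurable a) :
    IsInvariantSet θ (dilateMap θ a φ) (dilateSet a M) where
  isRandomSet := hM.isRandomSet.dilate ha
  invariant t ht ω := by
    rintro _ ⟨_, ⟨x, hx, rfl⟩, rfl⟩
    exact ⟨φ t ω x, hM.invariant t ht ω (mem_image_of_mem _ hx),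
      (dilateMap_smul θ a φ t ω x).symm⟩

lemma IsInvariantManifold.dilate {πp : H →L[ℝ] H} {θ : ℝ → Ω → Ω} {φ : ℝ → Ω → H → H}
    {M : Ω → Set H} (hM : IsInvariantManifold πp θ φ M) {a : Ω → ℝ} (ha : Measurable a) :
    IsInvariantManifold πp θ (dilateMap θ a φ) (dilateSet a M) where
  isInvariantSet := hM.isInvariantSet.dilate ha
  graph := by
    obtain ⟨γ, hγ⟩ := hM.graph
    -- Conjugating the graph map by the dilation works because the same scalar acts on both
    -- components.
    refine ⟨fun ω x => Real.exp (a ω) • γ ω (Real.exp (-a ω) • x), fun ω => ⟨?_, ?_⟩⟩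
    · obtain ⟨K, hK⟩ := (hγ ω).1
      exact ⟨_, (lipschitzWith_smul (Real.exp (a ω))).comp
        (hK.comp (lipschitzWith_smul (Real.exp (-a ω))))⟩
    · rw [dilateSet, (hγ ω).2, ← range_comp]
      refine Subset.antisymm ?_ ?_
      · rintro _ ⟨x, rfl⟩
        exact ⟨Real.exp (a ω) • x, by simp [smul_smul, ← Real.exp_add]⟩
      · rintro _ ⟨x, rfl⟩
        exact ⟨Real.exp (-a ω) • x, by simp [smul_smul, ← Real.exp_add]⟩

lemma IsUnstableManifold.dilate {πp : H →L[ℝ] H} {θ : ℝ → Ω → Ω} {φ : ℝ → Ω → H → H}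
    {M : Ω → Set H} (hM : IsUnstableManifold πp θ φ M) {a : Ω → ℝ} (ha : Measurable a)
    (hθ : ∀ t ω, θ t (θ (-t) ω) = ω)
    (hgrowth : ∀ ω, ∀ ε > 0, ∃ C : ℝ, ∀ t, 0 ≤ t → a (θ (-t) ω) ≤ C + ε * t) :
    IsUnstableManifold πp θ (dilateMap θ a φ) (dilateSet a M) where
  isInvariantManifold := hM.isInvariantManifold.dilate ha
  backward := by
    rintro ω _ ⟨x, hx, rfl⟩
    obtain ⟨ξ, hξ, μ, hμ, hlim⟩ := hM.backward ω x hx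
    -- Half of the rate `μ` is given up to pay for the growth of `a` along the backward orbit; the
    -- other half survives.
    refine ⟨fun t => Real.exp (a (θ (-t) ω)) • ξ t, fun t ht => ⟨?_, ?_⟩, μ / 2, half_pos hμ, ?_⟩
    · exact mem_image_of_mem _ (hξ t ht).1
    · rw [dilateMap_smul, (hξ t ht).2, hθ]
    · obtain ⟨C, hC⟩ := hgrowth ω (μ / 2) (half_pos hμ)
      have hlim' := hlim.const_mul (Real.exp C)
      rw [mul_zero] at hlim'
      refine squeeze_zero' (Eventually.of_forall fun t => by positivity) ?_ hlim'
      filter_upwards [eventually_ge_atTop 0] with t ht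
      rw [norm_smul, Real.norm_eq_abs, Real.abs_exp, ← mul_assoc, ← mul_assoc, ← Real.exp_add,
        ← Real.exp_add]
      refine mul_le_mul_of_nonneg_right (Real.exp_le_exp.2 ?_) (norm_nonneg _)
      linarith [hC t ht]

end Dilation

end RandomManifold

theorem theorem4p4
    {H : Type*} [NormedAddCommGroup H] [NormedSpace ℝ H] [CompleteSpace H]
    [TopologicalSpace.SeparableSpace H]
    (P : Measure RandomManifold.PathSpace) (hP : RandomManifold.IsWienerMeasure P)
    (Ω : Set RandomManifold.PathSpace) (hΩ : RandomManifold.IsNoiseSpace P Ω)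
    (A : H →ₗ.[ℝ] H) (S : ℝ → H →L[ℝ] H) (hS : RandomManifold.IsC0Semigroup S)
    (hA : RandomManifold.IsGenerator A S)
    (πp : H →L[ℝ] H) (lamHat lamCheck : ℝ)
    (hdich : RandomManifold.ExpDichotomy S πp lamHat lamCheck)
    (F : H → H) (L : ℝ) (hL : 0 < L)
    (hFp : ∀ x₁ x₂ : H, ‖πp (F x₁ - F x₂)‖ ≤ L * ‖x₁ - x₂‖)
    (hFm : ∀ x₁ x₂ : H, ‖RandomManifold.complProj πp (F x₁ - F x₂)‖ ≤ L * ‖x₁ - x₂‖)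
    (hF0 : F 0 = 0)
    (φ : ℝ → Ω → H → H) (hφ : RandomManifold.IsMildSolutionMap hΩ S F φ)
    (M : Ω → Set H) :
    (RandomManifold.IsInvariantManifold πp (RandomManifold.flow hΩ) φ M ↔
      RandomManifold.IsInvariantManifold πp (RandomManifold.flow hΩ)
        (RandomManifold.conjugate hΩ φ) (RandomManifold.conjugateSet M)) ∧
    (RandomManifold.IsUnstableManifold πp (RandomManifold.flow hΩ) φ M ↔
      RandomManifold.IsUnstableManifold πp (RandomManifold.flow hΩ)
        (RandomManifold.conjugate hΩ φ) (RandomManifold.conjugateSet M)) := by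
  have hmeas : Measurable fun ω : Ω => RandomManifold.ouVar ω.1 :=
    RandomManifold.measurable_ouVar.comp measurable_subtype_coe
  have hθ := RandomManifold.flow_flow_neg hΩ
  -- The bound is two-sided because the converse dilates by `e^{-z}`.
  have hgrowth : ∀ ω : Ω, ∀ ε > 0, ∃ C : ℝ, ∀ t, 0 ≤ t →
      |RandomManifold.ouVar (RandomManifold.flow hΩ (-t) ω).1| ≤ C + ε * t :=
    fun ω ε hε => RandomManifold.exists_abs_ouVar_shift_neg_le (hΩ.sublinear_atBot ω.1 ω.2) hε
  have hφ' : RandomManifold.conjugate hΩ φ = RandomManifold.dilateMap (RandomManifold.flow hΩ)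
      (fun ω : Ω => RandomManifold.ouVar ω.1) φ := rfl
  have hM' : RandomManifold.conjugateSet M =
      RandomManifold.dilateSet (fun ω : Ω => RandomManifold.ouVar ω.1) M := rfl
  rw [hφ', hM']
  refine ⟨⟨fun h => h.dilate hmeas, fun h => ?_⟩, ⟨fun h => ?_, fun h => ?_⟩⟩
  -- Dilating back by `e^{-z}` recovers `φ` and `M` exactly.
  · simpa only [RandomManifold.dilateMap_neg_dilateMap, RandomManifold.dilateSet_neg_dilateSet]
      using h.dilate hmeas.neg
  · refine h.dilate hmeas hθ fun ω ε hε => ?_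
    obtain ⟨C, hC⟩ := hgrowth ω ε hε
    exact ⟨C, fun t ht => (le_abs_self _).trans (hC t ht)⟩
  · have h' := h.dilate hmeas.neg hθ fun ω ε hε => by
      obtain ⟨C, hC⟩ := hgrowth ω ε hε
      exact ⟨C, fun t ht => (neg_le_abs _).trans (hC t ht)⟩
    simpa only [RandomManifold.dilateMap_neg_dilateMap, RandomManifold.dilateSet_neg_dilateSet]
      using h'
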